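/- Let $\tilde\Omega(n)$ be the set of strict partial orders $\prec$ on $\{0,\dots,n-1\}$ with $i\prec j\Rightarrow i<j$ (labeled causets of cardinality $n\ge 1$), and $\tilde\Omega$ the set of strict partial orders on $\mathbb N$ with $i\prec j\Rightarrow i<j$ (infinite labeled causets). An $n$-order (infinite order) is an isomorphism class of elements of $\tilde\Omega(n)$ (of $\tilde\Omega$). A stem in a causet is a finite subset containing the past of each of its elements; a finite order $A$ is a stem in an order $B$ (an $n$-stem, if $A$ is an $n$-order) if a representative of $A$ is isomorphic to the subcauset on a stem in a representative of $B$. For $\tilde C_n\in\tilde\Omega(n)$ let $cyl(\tilde C_n)=\{\tilde D\in\tilde\Omega : \tilde D|_{\{0,\dots,n-1\}}=\tilde C_n\}$, and let $\tilde{\mathcal R}$ be the $\sigma$-algebra on $\tilde\Omega$ generated by all cylinder sets. For a finite order $A$ let $stem(A)=\{\tilde D\in\tilde\Omega : A \text{ is a stem in } [\tilde D]\}$, and let $\mathcal R(\mathcal S)$, the stem algebra, be the $\sigma$-algebra on $\tilde\Omega$ generated by all stem sets. Covtree is the tree whose nodes in level $n\ge 1$ are the nonempty sets $\Gamma_n$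 of $n$-orders that have a certificate, i.e. a (finite or infinite) order whose set of $n$-stems is exactly $\Gamma_n$; $\Gamma_{n+1}$ is directly above $\Gamma_n$ if $\Gamma_n$ is the set of $n$-stems of elements of $\Gamma_{n+1}$. Put $cert(\Gamma_n)=\{\tilde D\in\tilde\Omega : [\tilde D]\text{ is a certificate of }\Gamma_n\}$. Labeled poscau is the tree whose nodes in level $n\ge1$ are the elements of $\tilde\Omega(n)$, with $\tilde C_{n+1}$ directly above $\tilde C_n$ if $\tilde C_{n+1}|_{\{0,\dots,n-1\}}=\tilde C_n$. A random walk on either tree is an assignment of transition probabilities to its links, such that the probabilities on the links going up from each node sum to $1$. A walk on labeled poscau induces a measure $\tilde\mu$ on $\tilde{\mathcal R}$ if, for every node $\tilde C_n$, $\tilde\mu(cyl(\tilde C_n))$ is the product of the transition probabilities on the links of the path from the root to $\tilde C_n$; it then induces the restriction of $\tilde\mu$ on $\mathcal R(\mathcal S)$. A walk on covtree induces a measure $\mu$ on $\mathcal R(\mathcal S)$ if, for every node $\Gamma_n$, $\mu(cert(\Gamma_n))$ is the product of the transition probabilities on the links of the path from the root to $\Gamma_n$. **Lemma.** $\mathcal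 R(\mathcal S)\subseteq\tilde{\mathcal R}$, and for every measure $\mu$ on $\mathcal R(\mathcal S)$ there is a measure $\tilde\mu$ on $\tilde{\mathcal R}$ that extends it: $\tilde\mu(E)=\mu(E)$ for all $E\in\mathcal R(\mathcal S)$. Consequently, a measure on $\mathcal R(\mathcal S)$ is induced by a random walk on covtree if and only if it is induced by a random walk on labeled poscau, and these are exactly the probability measures on $\mathcal R(\mathcal S)$. -/

import Mathlib

namespace Causet

/-- A labeled causet on the linearly ordered ground set `α`: a (strict, irreflexive) partial order
`rel` on `α` such that `rel i j` implies `i < j`. (Irreflexivity follows from `lt_of_rel`.)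
Finite labeled causets of cardinality `n` are the case `α = Fin n`, the interval `{0, …, n - 1}`;
infinite labeled causets are the case `α = ℕ`. -/
@[ext]
structure LabeledCauset (α : Type) [LinearOrder α] where
  rel : α → α → Prop
  trans' : ∀ i j k, rel i j → rel j k → rel i k
  lt_of_rel : ∀ i j, rel i j → i < j

variable {α β : Type} [LinearOrder α] [LinearOrder β]

/-- The causet induced on `β` by an order embedding of ground sets. -/
def LabeledCauset.comap (C : LabeledCauset α) (f : β ↪o α) : LabeledCauset β where
  rel i j := C.rel (f i) (f j)
  trans' _ _ _ h₁ h₂ := C.trans' _ _ _ h₁ h₂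
  lt_of_rel _ _ h := f.lt_iff_lt.1 (C.lt_of_rel _ _ h)

/-- The subcauset of `C` on a finite subset `T` of the ground set. -/
def LabeledCauset.sub (C : LabeledCauset α) (T : Finset α) : LabeledCauset T :=
  C.comap (OrderEmbedding.subtype (fun x => x ∈ T))

/-- The restriction of an infinite labeled causet to `{0, …, n - 1}`. -/
def LabeledCauset.restrict (D : LabeledCauset ℕ) (n : ℕ) : LabeledCauset (Fin n) :=
  D.comap (Fin.valOrderEmb n)

/-- The restriction of a labeled causet on `{0, …, n}` to `{0, …, n - 1}`. -/
def LabeledCauset.init {n : ℕ} (C : LabeledCauset (Fin (n + 1))) : LabeledCauset (Fin n) :=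
  C.comap Fin.castSuccOrderEmb

/-- Isomorphism of causets: a bijection preserving and reflecting the relations (it need not
respect the labels). -/
def LabeledCauset.Iso (C : LabeledCauset α) (D : LabeledCauset β) : Prop :=
  Nonempty (C.rel ≃r D.rel)

/-- A finite subset `T` of the ground set is (the ground set of) a stem in `C` if it contains the
past of each of its elements. -/
def LabeledCauset.IsStem (C : LabeledCauset α) (T : Finset α) : Prop :=
  ∀ x ∈ T, ∀ y, C.rel y x → y ∈ T

/-- Isomorphism as an equivalence relation on labeled causets with the same ground set. -/
instance isoSetoid (α : Type) [LinearOrder α] : Setoid (LabeledCauset α) where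
  r C D := C.Iso D
  iseqv :=
    { refl := fun C => ⟨RelIso.refl C.rel⟩
      symm := fun ⟨e⟩ => ⟨e.symm⟩
      trans := fun ⟨e⟩ ⟨f⟩ => ⟨e.trans f⟩ }

/-- Unlabeled causets: isomorphism classes of labeled causets. `UnlabeledCauset (Fin n)` is the set
of `n`-orders and `UnlabeledCauset ℕ` is the set of infinite orders. -/
def UnlabeledCauset (α : Type) [LinearOrder α] : Type := Quotient (isoSetoid α)

/-- The order (isomorphism class) of a labeled causet. -/
def LabeledCauset.toOrder (C : LabeledCauset α) : UnlabeledCauset α := Quotient.mk _ C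

/-- The `n`-order `A` is a stem in the (finite or infinite) order `B`: for some representatives
`A'` of `A` and `B'` of `B`, `A'` is, up to isomorphism, the subcauset on a stem in `B'`. -/
def IsStemIn {n : ℕ} (A : UnlabeledCauset (Fin n)) (B : UnlabeledCauset α) : Prop :=
  ∃ (A' : LabeledCauset (Fin n)) (B' : LabeledCauset α), A'.toOrder = A ∧ B'.toOrder = B ∧
    ∃ T : Finset α, B'.IsStem T ∧ A'.Iso (B'.sub T)

/-- The cylinder set of a finite labeled causet. -/
def cyl {n : ℕ} (C : LabeledCauset (Fin n)) : Set (LabeledCauset ℕ) :=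
  {D | D.restrict n = C}

/-- The σ-algebra on the set of infinite labeled causets generated by the cylinder sets. -/
abbrev cylinderAlgebra : MeasurableSpace (LabeledCauset ℕ) :=
  MeasurableSpace.generateFrom
    {E | ∃ (n : ℕ) (C : LabeledCauset (Fin n)), 0 < n ∧ E = cyl C}

/-- The stem set of an `n`-order. -/
def stem {n : ℕ} (A : UnlabeledCauset (Fin n)) : Set (LabeledCauset ℕ) :=
  {D | IsStemIn A D.toOrder}

/-- The stem algebra: the σ-algebra on the set of infinite labeled causets generated by the stem
sets of finite orders. -/
abbrev stemAlgebra : MeasurableSpace (LabeledCauset ℕ) :=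
  MeasurableSpace.generateFrom
    {E | ∃ (n : ℕ) (A : UnlabeledCauset (Fin n)), 0 < n ∧ E = stem A}

/-- The order `B` is a certificate of the set `Γ` of `n`-orders: `Γ` is the set of all `n`-stems
in `B`. -/
def IsCertificate {n : ℕ} (B : UnlabeledCauset α) (Γ : Set (UnlabeledCauset (Fin n))) : Prop :=
  Γ = {A | IsStemIn A B}

/-- The nodes of covtree in level `k + 1` (so that `k = 0` is the level of the root): the nonempty
sets of `(k + 1)`-orders which have a certificate, finite or infinite. -/
def CovtreeNode (k : ℕ) : Type :=
  {Γ : Set (UnlabeledCauset (Fin (k + 1))) // Γ.Nonempty ∧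
    ((∃ (m : ℕ) (B : UnlabeledCauset (Fin m)), 0 < m ∧ IsCertificate B Γ) ∨
      ∃ B : UnlabeledCauset ℕ, IsCertificate B Γ)}

/-- The set of `n`-stems of elements of a set of `(n + 1)`-orders. -/
def oMinus {n : ℕ} (Γ : Set (UnlabeledCauset (Fin (n + 1)))) : Set (UnlabeledCauset (Fin n)) :=
  {B | ∃ A ∈ Γ, IsStemIn B A}

/-- The links of covtree: `Γ'` is directly above `Γ`. -/
def covtreeLink (k : ℕ) (Γ : CovtreeNode k) (Γ' : CovtreeNode (k + 1)) : Prop :=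
  oMinus Γ'.1 = Γ.1

/-- The certificate set of a node of covtree, as a covariant event: the infinite labeled causets
whose order is a certificate of the node. -/
def cert (k : ℕ) (Γ : CovtreeNode k) : Set (LabeledCauset ℕ) :=
  {D | IsCertificate D.toOrder Γ.1}

/-- The nodes of labeled poscau in level `k + 1`: the labeled causets of cardinality `k + 1`. -/
abbrev PoscauNode (k : ℕ) : Type := LabeledCauset (Fin (k + 1))

/-- The links of labeled poscau: `C'` is directly above `C`, i.e. `C` is the stem
`{0, …, k}` in `C'`. -/
def poscauLink (k : ℕ) (C : PoscauNode k) (C' : PoscauNode (k + 1)) : Prop :=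
  C'.init = C

/-- An upward random walk on a tree given by its levels `N k` and its links: transition
probabilities, carried by the links, that satisfy the Markov sum rule. -/
structure TreeWalk (N : ℕ → Type) (link : ∀ k, N k → N (k + 1) → Prop) where
  prob : ∀ k, N k → N (k + 1) → ENNReal
  prob_eq_zero : ∀ k x y, ¬ link k x y → prob k x y = 0
  sum_eq_one : ∀ k x, ∑' y, prob k x y = 1

/-- The walk induces the measure `μ`, where `event k x` is the event that corresponds to the walk
arriving at the node `x`: for every path `γ 0, …, γ k` of links starting at the root, the measure of
the event of `γ k` is the product of the transition probabilities on the links of the path. (Both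
trees below have a single node in their lowest level `k = 0`, the root.) -/
def TreeWalk.Induces {N : ℕ → Type} {link : ∀ k, N k → N (k + 1) → Prop} (W : TreeWalk N link)
    {Ω : Type} {mΩ : MeasurableSpace Ω} (event : ∀ k, N k → Set Ω)
    (μ : MeasureTheory.Measure Ω) : Prop :=
  ∀ (k : ℕ) (γ : ∀ i, N i), (∀ i < k, link i (γ i) (γ (i + 1))) →
    μ (event k (γ k)) = ∏ i ∈ Finset.range k, W.prob i (γ i) (γ (i + 1))

/-- Random walks on covtree. -/
abbrev CovtreeWalk : Type := TreeWalk CovtreeNode covtreeLink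

/-- Random walks on labeled poscau. -/
abbrev PoscauWalk : Type := TreeWalk PoscauNode poscauLink

/-- `ν`, a measure on the σ-algebra generated by the cylinder sets, is an extension of `μ`, a measure
on the stem algebra. -/
def Extends (ν : @MeasureTheory.Measure (LabeledCauset ℕ) cylinderAlgebra)
    (μ : @MeasureTheory.Measure (LabeledCauset ℕ) stemAlgebra) : Prop :=
  ∀ E : Set (LabeledCauset ℕ), @MeasurableSet _ stemAlgebra E → ν E = μ E

/-- A measure on the stem algebra that is induced by a random walk on covtree. -/
def IsCovtreeMeasure (μ : @MeasureTheory.Measure (LabeledCauset ℕ) stemAlgebra) : Prop :=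
  ∃ W : CovtreeWalk, W.Induces cert μ

/-- A measure on the stem algebra that is induced by a random walk on labeled poscau: the restriction
of the measure which the walk induces on the σ-algebra generated by the cylinder sets. -/
def IsPoscauMeasure (μ : @MeasureTheory.Measure (LabeledCauset ℕ) stemAlgebra) : Prop :=
  ∃ (V : PoscauWalk) (ν : @MeasureTheory.Measure (LabeledCauset ℕ) cylinderAlgebra),
    V.Induces (fun _ C => cyl C) ν ∧ Extends ν μ

end Causet

namespace Causet

open MeasureTheory Filter
open scoped InitialSeg

/-! A stem is a downward closed finite set, so "`A` is a stem in `B`" means that a representative of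
`A` embeds in one of `B` as an initial segment (`isStemIn_toOrder`); stems therefore compose. A
finite stem uses finitely many labels, so it already occurs in some finite restriction, which makes
every stem set a countable union of cylinders.

For the extension, the point is a map `s` from infinite labeled causets to themselves, measurable
from the stem algebra to the cylinder algebra, such that `s D` has the same finite stems as `D`
(`exists_measurable_selection`). It is not required that `s D` and `D` be isomorphic: events of the
stem algebra cannot separate causets with the same stems (`mem_iff_of_stems_eq`), so the preimage
under `s` of such an event is the event itself, and the pushforward of `μ` along `s` extends `μ`.
The map is built greedily: finite labeled causets are enumerated, and at each stage the current
finite stem of `D` is enlarged to the first one in the enumeration that extends it, is still a stem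
in `D`, and contains the next listed stem of `D`. Each choice depends only on which stems `D` has,
hence is measurable; the limit has exactly the stems of `D`.

In both trees the events at the nodes directly above a node partition its event, so conditional
probabilities turn any probability measure into a walk (`exists_treeWalk_induces`). Conversely, the
empty product at the root gives total mass one. -/

/-- An initial segment whose range lies in that of another one factors through it. -/
theorem nonempty_initialSeg_of_range_subset {α β γ : Type} {r : γ → γ → Prop} {s : β → β → Prop}
    {t : α → α → Prop} (f : r ≼i t) (g : s ≼i t) (h : ∀ i, ∃ j, g j = f i) :
    Nonempty (r ≼i s) := by
  choose φ hφ using h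
  refine ⟨⟨⟨⟨φ, fun i j hij => f.injective ?_⟩, fun {i j} => ?_⟩, fun i b hb => ?_⟩⟩
  · exact (hφ i).symm.trans ((congrArg g hij).trans (hφ j))
  · change s (φ i) (φ j) ↔ r i j
    rw [← g.map_rel_iff, hφ, hφ, f.map_rel_iff]
  · change s b (φ i) at hb
    rw [← g.map_rel_iff, hφ] at hb
    obtain ⟨j, hj⟩ := f.mem_range_of_rel hb
    exact ⟨j, g.injective ((hφ j).trans hj)⟩

/-! ### Stems as initial segments -/

section Basic

variable {α β : Type} [LinearOrder α] [LinearOrder β]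

/-- The inclusion of a stem is an initial segment. -/
def LabeledCauset.IsStem.initialSeg {D : LabeledCauset α} {T : Finset α} (hT : D.IsStem T) :
    (D.sub T).rel ≼i D.rel where
  toFun x := x.1
  inj' := Subtype.val_injective
  map_rel_iff' := Iff.rfl
  mem_range_of_rel' a b h := ⟨⟨b, hT a.1 a.2 b h⟩, rfl⟩

/-- The range of an initial segment is a stem, and the inclusion of a stem is an initial segment;
isomorphisms of representatives are absorbed by composition. -/
theorem isStemIn_toOrder {n : ℕ} {A : LabeledCauset (Fin n)} {D : LabeledCauset α} :
    IsStemIn A.toOrder D.toOrder ↔ Nonempty (A.rel ≼i D.rel) := by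
  constructor
  · rintro ⟨A', B', hA, hB, T, hT, ⟨e⟩⟩
    obtain ⟨a⟩ : A'.Iso A := Quotient.exact hA
    obtain ⟨b⟩ : B'.Iso D := Quotient.exact hB
    exact ⟨(((a.symm.toInitialSeg).trans e.toInitialSeg).trans hT.initialSeg).trans
      b.toInitialSeg⟩
  · rintro ⟨f⟩
    have hmem : ∀ x, x ∈ Finset.univ.map f.toRelEmbedding.toEmbedding ↔ ∃ i, f i = x := by
      intro x
      simp only [Finset.mem_map, Finset.mem_univ, true_and]
      rfl
    refine ⟨A, D, rfl, rfl, Finset.univ.map f.toRelEmbedding.toEmbedding, ?_, ⟨?_⟩⟩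
    · intro x hx y hy
      obtain ⟨i, rfl⟩ := (hmem x).1 hx
      exact (hmem y).2 (f.mem_range_of_rel hy)
    · refine ⟨Equiv.ofBijective (fun i => ⟨f i, (hmem _).2 ⟨i, rfl⟩⟩) ⟨?_, ?_⟩, ?_⟩
      · intro i j h
        exact f.injective (congrArg Subtype.val h)
      · rintro ⟨x, hx⟩
        obtain ⟨i, rfl⟩ := (hmem x).1 hx
        exact ⟨i, rfl⟩
      · intro i j
        exact f.map_rel_iff

theorem isStemIn_trans {m n : ℕ} {A : UnlabeledCauset (Fin m)} {C : LabeledCauset (Fin n)}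
    {D : LabeledCauset α} (h₁ : IsStemIn A C.toOrder) (h₂ : IsStemIn C.toOrder D.toOrder) :
    IsStemIn A D.toOrder := by
  induction A using Quotient.inductionOn with | _ A
  obtain ⟨f⟩ := isStemIn_toOrder.1 h₁
  obtain ⟨g⟩ := isStemIn_toOrder.1 h₂
  exact isStemIn_toOrder.2 ⟨f.trans g⟩

instance [Finite α] : Finite (LabeledCauset α) :=
  Finite.of_injective LabeledCauset.rel fun _ _ h => LabeledCauset.ext h

instance [Finite α] : Finite (UnlabeledCauset α) :=
  inferInstanceAs (Finite (Quotient (isoSetoid α)))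

instance [Subsingleton α] : Subsingleton (LabeledCauset α) where
  allEq C D := by
    have key : ∀ (E : LabeledCauset α) i j, ¬ E.rel i j := fun E i j h =>
      (E.lt_of_rel i j h).ne (Subsingleton.elim i j)
    ext i j
    exact iff_of_false (key C i j) (key D i j)

instance [Subsingleton α] : Subsingleton (UnlabeledCauset α) :=
  inferInstanceAs (Subsingleton (Quotient (isoSetoid α)))

end Basic

/-! ### Finite restrictions, chain extensions and relabelings -/

section Restrict

/-- The restriction of an infinite labeled causet to `{0, …, n - 1}` is an initial segment. -/
def LabeledCauset.restrictInitialSeg (D : LabeledCauset ℕ) (n : ℕ) :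
    (D.restrict n).rel ≼i D.rel where
  toFun x := x.1
  inj' := Fin.val_injective
  map_rel_iff' := Iff.rfl
  mem_range_of_rel' a b h := ⟨⟨b, (D.lt_of_rel _ _ h).trans a.2⟩, rfl⟩

theorem LabeledCauset.restrict_eq_iff {D : LabeledCauset ℕ} {n : ℕ} {C : LabeledCauset (Fin n)} :
    D.restrict n = C ↔ ∀ i j : Fin n, D.rel i j ↔ C.rel i j := by
  constructor
  · rintro rfl i j
    rfl
  · intro h
    ext i j
    exact h i j

theorem LabeledCauset.restrict_eq_of_le {D E : LabeledCauset ℕ} {m n : ℕ} (hmn : m ≤ n)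
    (h : D.restrict n = E.restrict n) : D.restrict m = E.restrict m := by
  rw [restrict_eq_iff] at h ⊢
  exact fun i j => h (Fin.castLE hmn i) (Fin.castLE hmn j)

theorem isStemIn_restrict (D : LabeledCauset ℕ) (n : ℕ) :
    IsStemIn (D.restrict n).toOrder D.toOrder :=
  isStemIn_toOrder.2 ⟨D.restrictInitialSeg n⟩

/-- A finite stem in an infinite labeled causet is a stem in all its large restrictions. -/
theorem exists_isStemIn_restrict {n : ℕ} {A : UnlabeledCauset (Fin n)} {D : LabeledCauset ℕ}
    (h : IsStemIn A D.toOrder) :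
    ∃ N, ∀ m, N ≤ m → IsStemIn A (D.restrict m).toOrder := by
  induction A using Quotient.inductionOn with | _ A
  obtain ⟨f⟩ := isStemIn_toOrder.1 h
  obtain ⟨N, hN⟩ := (Set.finite_range f).bddAbove
  refine ⟨N + 1, fun m hm => isStemIn_toOrder.2 ?_⟩
  exact nonempty_initialSeg_of_range_subset f (D.restrictInitialSeg m)
    fun i => ⟨⟨f i, (Nat.lt_succ_of_le (hN ⟨i, rfl⟩)).trans_le hm⟩, rfl⟩

/-- The infinite labeled causet obtained by putting an infinite chain above a finite one. -/
def LabeledCauset.extend {n : ℕ} (C : LabeledCauset (Fin n)) : LabeledCauset ℕ where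
  rel i j := i < j ∧ ∀ (hi : i < n) (hj : j < n), C.rel ⟨i, hi⟩ ⟨j, hj⟩
  trans' _ _ _ h₁ h₂ := ⟨h₁.1.trans h₂.1, fun hi hk =>
    C.trans' _ _ _ (h₁.2 hi (h₂.1.trans hk)) (h₂.2 (h₂.1.trans hk) hk)⟩
  lt_of_rel _ _ h := h.1

theorem LabeledCauset.restrict_extend {n : ℕ} (C : LabeledCauset (Fin n)) :
    C.extend.restrict n = C :=
  restrict_eq_iff.2 fun i j => ⟨fun h => h.2 i.2 j.2, fun h => ⟨C.lt_of_rel _ _ h, fun _ _ => h⟩⟩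

/-- A stem with at most `m` elements cannot reach the added chain, since each chain element has all
`m` elements of `B` in its past. -/
theorem isStemIn_extend_iff {m n : ℕ} (hnm : n ≤ m) {A : UnlabeledCauset (Fin n)}
    {B : LabeledCauset (Fin m)} :
    IsStemIn A B.extend.toOrder ↔ IsStemIn A B.toOrder := by
  constructor
  · intro h
    induction A using Quotient.inductionOn with | _ A
    obtain ⟨f⟩ := isStemIn_toOrder.1 h
    have hlt : ∀ i, f i < m := by
      by_contra! hc
      obtain ⟨i, hi⟩ := hc
      -- If `f i` lies in the chain, all of `0, …, m - 1` precede it and so are values of `f` at the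
      -- other `n - 1 < m` indices.
      have hsub : Finset.range m ⊆ (Finset.univ.erase i).image f := by
        intro j hj
        have hjm := Finset.mem_range.1 hj
        obtain ⟨k, hk⟩ := f.mem_range_of_rel (a := i) (b := j)
          ⟨hjm.trans_le hi, fun _ h => absurd h hi.not_gt⟩
        refine Finset.mem_image.2 ⟨k, Finset.mem_erase.2 ⟨?_, Finset.mem_univ _⟩, hk⟩
        rintro rfl
        omega
      have h1 := (Finset.card_le_card hsub).trans Finset.card_image_le
      rw [Finset.card_erase_of_mem (Finset.mem_univ _), Finset.card_univ, Fintype.card_fin,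
        Finset.card_range] at h1
      have := i.pos
      omega
    have := nonempty_initialSeg_of_range_subset f (B.extend.restrictInitialSeg m)
      fun i => ⟨⟨f i, hlt i⟩, rfl⟩
    rw [B.restrict_extend] at this
    exact isStemIn_toOrder.2 this
  · intro h
    have h2 := isStemIn_restrict B.extend m
    rw [B.restrict_extend] at h2
    exact isStemIn_trans h h2

theorem le_of_isStemIn {m n : ℕ} {A : UnlabeledCauset (Fin n)} {B : UnlabeledCauset (Fin m)}
    (h : IsStemIn A B) : n ≤ m := by
  induction A using Quotient.inductionOn with | _ A
  induction B using Quotient.inductionOn with | _ B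
  obtain ⟨f⟩ := isStemIn_toOrder.1 h
  simpa using Fintype.card_le_of_injective f f.injective

/-- An infinite labeled causet can be relabeled so that any given finite stem comes first. -/
theorem exists_relabeling {n : ℕ} {C : LabeledCauset (Fin n)} {D : LabeledCauset ℕ}
    (h : IsStemIn C.toOrder D.toOrder) :
    ∃ D' : LabeledCauset ℕ, D'.restrict n = C ∧ D'.toOrder = D.toOrder := by
  obtain ⟨f⟩ := isStemIn_toOrder.1 h
  have hinf : (Set.range f)ᶜ.Infinite := (Set.finite_range f).infinite_compl
  have : Infinite ↥(Set.range f)ᶜ := hinf.to_subtype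
  classical
  let g : ℕ ≃o ↥(Set.range f)ᶜ := Nat.Subtype.orderIsoOfNat _
  -- The stem takes the labels below `n`; the remaining elements follow in their original order.
  let e : ℕ → ℕ := fun i => if hi : i < n then f ⟨i, hi⟩ else (g (i - n)).1
  have e_lt : ∀ i (hi : i < n), e i = f ⟨i, hi⟩ := fun i hi => dif_pos hi
  have e_ge : ∀ i, n ≤ i → e i = (g (i - n)).1 := fun i hi => dif_neg hi.not_gt
  have e_range : ∀ i, e i ∈ Set.range f → i < n := by
    intro i hi
    by_contra hc
    rw [e_ge i (not_lt.1 hc)] at hi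
    exact (g (i - n)).2 hi
  have e_inj : Function.Injective e := by
    intro i j hij
    by_cases hi : i < n
    · have hj : j < n := e_range j (hij ▸ e_lt i hi ▸ ⟨_, rfl⟩)
      rw [e_lt i hi, e_lt j hj] at hij
      simpa using f.injective hij
    · have hj : ¬ j < n := fun hj => hi (e_range i (hij ▸ e_lt j hj ▸ ⟨_, rfl⟩))
      rw [e_ge i (not_lt.1 hi), e_ge j (not_lt.1 hj)] at hij
      have := g.injective (Subtype.ext hij)
      omega
  have e_surj : Function.Surjective e := by
    intro x
    by_cases hx : x ∈ Set.range f
    · obtain ⟨i, rfl⟩ := hx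
      exact ⟨i, e_lt i i.2⟩
    · refine ⟨g.symm ⟨x, hx⟩ + n, ?_⟩
      rw [e_ge _ (Nat.le_add_left _ _)]
      simp
  let D' : LabeledCauset ℕ :=
    { rel := fun i j => D.rel (e i) (e j)
      trans' := fun _ _ _ h₁ h₂ => D.trans' _ _ _ h₁ h₂
      lt_of_rel := by
        intro i j hij
        -- The new labeling is natural: the past of a stem element stays in the stem, stem labels
        -- precede all others, and the others keep their order.
        by_cases hj : j < n
        · have hi : i < n := by
            rw [e_lt j hj] at hij
            exact e_range i (f.mem_range_of_rel hij)
          rw [e_lt i hi, e_lt j hj, f.map_rel_iff] at hij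
          exact C.lt_of_rel _ _ hij
        · by_cases hi : i < n
          · omega
          · have h1 := D.lt_of_rel _ _ hij
            rw [e_ge i (not_lt.1 hi), e_ge j (not_lt.1 hj)] at h1
            have h2 : i - n < j - n := g.lt_iff_lt.1 h1
            omega }
  refine ⟨D', LabeledCauset.restrict_eq_iff.2 fun i j => ?_, Quotient.sound ⟨?_⟩⟩
  · change D.rel (e i) (e j) ↔ _
    rw [e_lt i i.2, e_lt j j.2]
    exact f.map_rel_iff
  · exact ⟨Equiv.ofBijective e ⟨e_inj, e_surj⟩, Iff.rfl⟩

end Restrict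

/-! ### Stem algebra and cylinder algebra -/

section Algebras

theorem measurableSet_cyl {n : ℕ} (C : LabeledCauset (Fin (n + 1))) :
    MeasurableSet[cylinderAlgebra] (cyl C) :=
  MeasurableSpace.measurableSet_generateFrom ⟨n + 1, C, n.succ_pos, rfl⟩

theorem stemAlgebra_le_cylinderAlgebra : stemAlgebra ≤ cylinderAlgebra := by
  refine MeasurableSpace.generateFrom_le ?_
  rintro _ ⟨n, A, -, rfl⟩
  have : stem A = ⋃ (m : ℕ) (C : LabeledCauset (Fin (m + 1))) (_ : IsStemIn A C.toOrder),
      cyl C := by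
    ext D
    simp only [Set.mem_iUnion, exists_prop]
    constructor
    · intro h
      obtain ⟨N, hN⟩ := exists_isStemIn_restrict h
      exact ⟨N, _, hN _ N.le_succ, rfl⟩
    · rintro ⟨m, C, hA, rfl⟩
      exact isStemIn_trans hA (isStemIn_restrict D _)
  rw [this]
  exact .iUnion fun m => .iUnion fun C => .iUnion fun _ => measurableSet_cyl C

theorem measurableSet_stem {n : ℕ} (A : UnlabeledCauset (Fin n)) :
    MeasurableSet[stemAlgebra] (stem A) := by
  rcases n.eq_zero_or_pos with rfl | hn
  · have : stem A = Set.univ := by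
      ext D
      simpa [stem, Subsingleton.elim A (D.restrict 0).toOrder] using isStemIn_restrict D 0
    rw [this]
    exact MeasurableSet.univ
  · exact MeasurableSpace.measurableSet_generateFrom ⟨n, A, hn, rfl⟩

theorem measurableSet_stem_imp {n : ℕ} (A : UnlabeledCauset (Fin n)) (p : Prop) :
    MeasurableSet[stemAlgebra] {D | D ∈ stem A → p} := by
  by_cases h : p
  · simp [h]
  · simpa only [h, imp_false] using! (measurableSet_stem A).compl

/-- Events in the stem algebra do not separate causets with the same stems. -/
theorem mem_iff_of_stems_eq {E : Set (LabeledCauset ℕ)} (hE : MeasurableSet[stemAlgebra] E)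
    {D D' : LabeledCauset ℕ}
    (h : ∀ (n : ℕ) (A : UnlabeledCauset (Fin n)), IsStemIn A D.toOrder ↔ IsStemIn A D'.toOrder) :
    D ∈ E ↔ D' ∈ E := by
  induction E, hE using MeasurableSpace.generateFrom_induction with
  | hC t ht _ =>
    obtain ⟨n, A, -, rfl⟩ := ht
    exact h n A
  | empty => simp
  | compl t _ ih => simpa using not_congr ih
  | iUnion s _ ih => simpa using exists_congr ih

end Algebras

/-! ### Measurable reconstruction of a causet from its stems -/

section Selection

/-- A finite labeled causet that is a stem in `D` can be enlarged to one that is still a stem in `D`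
and in which a given stem of `D` is a stem. -/
theorem exists_larger_stem {n l : ℕ} {C : LabeledCauset (Fin n)} {A : UnlabeledCauset (Fin l)}
    {D : LabeledCauset ℕ} (hC : IsStemIn C.toOrder D.toOrder) :
    ∃ (m : ℕ) (C' : LabeledCauset (Fin m)), n < m ∧ C'.extend.restrict n = C ∧
      IsStemIn C'.toOrder D.toOrder ∧ (IsStemIn A D.toOrder → IsStemIn A C'.toOrder) := by
  obtain ⟨D', rfl, hD'⟩ := exists_relabeling hC
  obtain ⟨N, hN⟩ : ∃ N, ∀ m, N ≤ m → IsStemIn A D.toOrder → IsStemIn A (D'.restrict m).toOrder := by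
    by_cases h : IsStemIn A D.toOrder
    · obtain ⟨N, hN⟩ := exists_isStemIn_restrict (hD' ▸ h)
      exact ⟨N, fun m hm _ => hN m hm⟩
    · exact ⟨0, fun _ _ h' => absurd h' h⟩
  refine ⟨max (n + 1) N, D'.restrict _, by omega, ?_, hD' ▸ isStemIn_restrict D' _,
    hN _ (le_max_right _ _)⟩
  exact LabeledCauset.restrict_eq_of_le (by omega) (LabeledCauset.restrict_extend _)

/-- The pointwise limit inferior of a sequence of infinite labeled causets. -/
def limitCauset (E : ℕ → LabeledCauset ℕ) : LabeledCauset ℕ where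
  rel i j := ∀ᶠ k in atTop, (E k).rel i j
  trans' i j l h₁ h₂ := by
    filter_upwards [h₁, h₂] with k hk₁ hk₂ using (E k).trans' _ _ _ hk₁ hk₂
  lt_of_rel i j h := by
    obtain ⟨k, hk⟩ := h.exists
    exact (E k).lt_of_rel _ _ hk

/-- From stage `k` on, the relations below `n k` no longer change, so the limit inferior takes their
value at stage `k`. -/
theorem limitCauset_restrict {E : ℕ → LabeledCauset ℕ} {n : ℕ → ℕ} (hn : Monotone n)
    (hE : ∀ k, (E (k + 1)).restrict (n k) = (E k).restrict (n k)) (k : ℕ) :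
    (limitCauset E).restrict (n k) = (E k).restrict (n k) := by
  have hl : ∀ l, k ≤ l → (E l).restrict (n k) = (E k).restrict (n k) := by
    intro l hkl
    induction l, hkl using Nat.le_induction with
    | base => rfl
    | succ l hkl ih => exact (LabeledCauset.restrict_eq_of_le (hn hkl) (hE l)).trans ih
  refine LabeledCauset.restrict_eq_iff.2 fun i j => ?_
  have h : ∀ᶠ l in atTop, ((E l).rel i j ↔ (E k).rel i j) := by
    filter_upwards [eventually_ge_atTop k] with l hkl
    exact LabeledCauset.restrict_eq_iff.1 (hl l hkl) i j
  exact (eventually_congr h).trans eventually_const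

/-- A finite stem of the limit lies below some label `N`, and `N ≤ n N` by strict monotonicity, so
stage `N` already contains it. -/
theorem limitCauset_isStemIn_iff {E : ℕ → LabeledCauset ℕ} {n : ℕ → ℕ} (hn : StrictMono n)
    (hE : ∀ k, (E (k + 1)).restrict (n k) = (E k).restrict (n k)) {l : ℕ}
    {A : UnlabeledCauset (Fin l)} :
    IsStemIn A (limitCauset E).toOrder ↔ ∃ k, IsStemIn A ((E k).restrict (n k)).toOrder := by
  constructor
  · intro h
    obtain ⟨N, hN⟩ := exists_isStemIn_restrict h
    exact ⟨N, limitCauset_restrict hn.monotone hE N ▸ hN _ hn.le_apply⟩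
  · rintro ⟨k, hk⟩
    rw [← limitCauset_restrict hn.monotone hE k] at hk
    exact isStemIn_trans hk (isStemIn_restrict _ _)

/-- A limit of finite labeled causets that depend measurably on a point is measurable. -/
theorem measurable_limitCauset {Ω : Type} [MeasurableSpace Ω] {E : ℕ → LabeledCauset ℕ}
    {f : ℕ → Ω → ℕ} (hf : ∀ k, Measurable (f k)) :
    Measurable[_, cylinderAlgebra] fun ω => limitCauset fun k => E (f k ω) := by
  refine measurable_generateFrom ?_
  rintro _ ⟨n, C, -, rfl⟩
  have hrel : ∀ i j : ℕ, MeasurableSet {ω | (limitCauset fun k => E (f k ω)).rel i j} := by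
    intro i j
    have : {ω | (limitCauset fun k => E (f k ω)).rel i j} =
        ⋃ N : ℕ, ⋂ (k : ℕ) (_ : N ≤ k), f k ⁻¹' {a | (E a).rel i j} := by
      ext ω
      simp [limitCauset, eventually_atTop]
    rw [this]
    exact .iUnion fun N => .iInter fun k => .iInter fun _ => hf k (MeasurableSet.of_discrete)
  have : (fun ω => limitCauset fun k => E (f k ω)) ⁻¹' cyl C =
      ⋂ (i : Fin n) (j : Fin n),
        {ω | (limitCauset fun k => E (f k ω)).rel i j ↔ C.rel i j} := by
    ext ω
    simp [cyl, LabeledCauset.restrict_eq_iff]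
  rw [this]
  refine .iInter fun i => .iInter fun j => ?_
  by_cases h : C.rel i j
  · simpa [h] using hrel i j
  · simpa [h, Set.compl_def] using (hrel i j).compl

/-- One step of the greedy construction of a labeled causet from its stems. -/
theorem exists_measurable_larger_stem {c : ℕ → Σ n, LabeledCauset (Fin n)}
    (hc : Function.Surjective c) {l : ℕ} (A : UnlabeledCauset (Fin l))
    {f : LabeledCauset ℕ → ℕ} (hf : Measurable[stemAlgebra] f)
    (hfs : ∀ D, IsStemIn (c (f D)).2.toOrder D.toOrder) :
    ∃ g : LabeledCauset ℕ → ℕ, Measurable[stemAlgebra] g ∧ ∀ D,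
      (c (f D)).1 < (c (g D)).1 ∧
      (c (g D)).2.extend.restrict (c (f D)).1 = (c (f D)).2 ∧
      IsStemIn (c (g D)).2.toOrder D.toOrder ∧
      (IsStemIn A D.toOrder → IsStemIn A (c (g D)).2.toOrder) := by
  classical
  -- With both codes fixed, the condition on `D` involves only membership in two stem sets. The
  -- least admissible code is then a measurable choice.
  let P : LabeledCauset ℕ → ℕ → ℕ → Prop := fun D i j =>
    (c i).1 < (c j).1 ∧ (c j).2.extend.restrict (c i).1 = (c i).2 ∧
      IsStemIn (c j).2.toOrder D.toOrder ∧
      (IsStemIn A D.toOrder → IsStemIn A (c j).2.toOrder)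
  have hP : ∀ i j, MeasurableSet[stemAlgebra] {D | P D i j} := by
    intro i j
    refine @MeasurableSet.inter _ stemAlgebra _ _ (@MeasurableSet.const _ stemAlgebra _) ?_
    refine @MeasurableSet.inter _ stemAlgebra _ _ (@MeasurableSet.const _ stemAlgebra _) ?_
    refine @MeasurableSet.inter _ stemAlgebra _ _ (measurableSet_stem _) ?_
    exact measurableSet_stem_imp A _
  have hex : ∀ D, ∃ j, P D (f D) j := by
    intro D
    obtain ⟨m, C', h⟩ := exists_larger_stem (A := A) (hfs D)
    obtain ⟨j, hj⟩ := hc ⟨m, C'⟩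
    refine ⟨j, ?_⟩
    change (c (f D)).1 < (c j).1 ∧ (c j).2.extend.restrict _ = _ ∧ _ ∧ (_ → _)
    rw [hj]
    exact h
  refine ⟨fun D => Nat.find (hex D), @measurable_find _ stemAlgebra _ _ hex fun j => ?_,
    fun D => Nat.find_spec (hex D)⟩
  -- Splitting by the countably many values of `f` reduces to fixed codes.
  have : {D | P D (f D) j} = ⋃ i, f ⁻¹' {i} ∩ {D | P D i j} := by
    ext D
    simp
  rw [this]
  exact MeasurableSet.iUnion fun i => (hf (MeasurableSet.singleton i)).inter (hP i j)

/-- There is a measurable choice of a labeled causet with prescribed stems. -/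
theorem exists_measurable_selection :
    ∃ s : LabeledCauset ℕ → LabeledCauset ℕ, Measurable[stemAlgebra, cylinderAlgebra] s ∧
      ∀ (D : LabeledCauset ℕ) (n : ℕ) (A : UnlabeledCauset (Fin n)),
        IsStemIn A (s D).toOrder ↔ IsStemIn A D.toOrder := by
  have D₀ : LabeledCauset ℕ := ⟨fun _ _ => False, fun _ _ _ h _ => h, fun _ _ h => h.elim⟩
  have : Nonempty (Σ n, LabeledCauset (Fin n)) := ⟨⟨0, D₀.restrict 0⟩⟩
  obtain ⟨c, hc⟩ := exists_surjective_nat (Σ n, LabeledCauset (Fin n))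
  let F := {f : LabeledCauset ℕ → ℕ //
    Measurable[stemAlgebra] f ∧ ∀ D, IsStemIn (c (f D)).2.toOrder D.toOrder}
  have step : ∀ (k : ℕ) (f : F), ∃ g : F, ∀ D,
      (c (f.1 D)).1 < (c (g.1 D)).1 ∧
      (c (g.1 D)).2.extend.restrict (c (f.1 D)).1 = (c (f.1 D)).2 ∧
      (IsStemIn (c k).2.toOrder D.toOrder →
        IsStemIn (c k).2.toOrder (c (g.1 D)).2.toOrder) := by
    intro k f
    obtain ⟨g, hg, h⟩ := exists_measurable_larger_stem hc (c k).2.toOrder f.2.1 f.2.2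
    exact ⟨⟨g, hg, fun D => (h D).2.2.1⟩, fun D => ⟨(h D).1, (h D).2.1, (h D).2.2.2⟩⟩
  choose next hnext using step
  obtain ⟨j₀, hj₀⟩ := hc ⟨0, D₀.restrict 0⟩
  -- The construction starts from the empty causet, a stem in everything.
  let f₀ : F := ⟨fun _ => j₀, measurable_const, fun D => by
    rw [hj₀, Subsingleton.elim (D₀.restrict 0) (D.restrict 0)]
    exact isStemIn_restrict D 0⟩
  let f : ℕ → F := fun k => Nat.rec f₀ next k
  have hf : ∀ k, f (k + 1) = next k (f k) := fun _ => rfl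
  refine ⟨fun D => limitCauset fun k => (c ((f k).1 D)).2.extend,
    @measurable_limitCauset _ stemAlgebra (fun a => (c a).2.extend) _ fun k => (f k).2.1, fun D n A => ?_⟩
  have hn : StrictMono fun k => (c ((f k).1 D)).1 :=
    strictMono_nat_of_lt_succ fun k => (hnext k (f k) D).1
  rw [limitCauset_isStemIn_iff hn fun k =>
    ((hnext k (f k) D).2.1).trans (LabeledCauset.restrict_extend _).symm]
  simp only [LabeledCauset.restrict_extend]
  constructor
  · rintro ⟨k, hk⟩
    exact isStemIn_trans hk ((f k).2.2 D)
  · intro h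
    induction A using Quotient.inductionOn with | _ A
    -- The representative of the stem has some code `k`, so the step from stage `k` to `k + 1`
    -- absorbs it.
    obtain ⟨k, hk⟩ := hc ⟨n, A⟩
    have := (hnext k (f k) D).2.2
    rw [hk] at this
    exact ⟨k + 1, this h⟩

/-- The extension is the pushforward along the measurable selection, which fixes every event of the
stem algebra under preimage. -/
theorem exists_extends (μ : @Measure (LabeledCauset ℕ) stemAlgebra) :
    ∃ ν : @Measure (LabeledCauset ℕ) cylinderAlgebra, Extends ν μ := by
  obtain ⟨s, hs, hstems⟩ := exists_measurable_selection
  refine ⟨@Measure.map _ _ stemAlgebra cylinderAlgebra s μ, fun E hE => ?_⟩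
  rw [@Measure.map_apply _ _ stemAlgebra cylinderAlgebra _ _ hs _
    (stemAlgebra_le_cylinderAlgebra E hE)]
  congr 1
  ext D
  exact mem_iff_of_stems_eq hE (hstems D)

end Selection

/-! ### Random walks and probability measures -/

section Walks

/-- A probability measure is induced by a random walk on a tree whose nodes are events, each of
which is partitioned by the events directly above it. -/
theorem exists_treeWalk_induces {N : ℕ → Type} {link : ∀ k, N k → N (k + 1) → Prop}
    [∀ k, Countable (N k)] {Ω : Type} {mΩ : MeasurableSpace Ω} {event : ∀ k, N k → Set Ω}
    (hmeas : ∀ k x, MeasurableSet (event k x)) (hroot : ∀ x, event 0 x = Set.univ)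
    (hsucc : ∀ k x, ∃ y, link k x y)
    (hlink : ∀ k x y, link k x y → event (k + 1) y ⊆ event k x)
    (hcover : ∀ k x, ∀ ω ∈ event k x, ∃ y, link k x y ∧ ω ∈ event (k + 1) y)
    (hdisj : ∀ k x y, ∀ ω ∈ event k x, ω ∈ event k y → x = y)
    (μ : Measure Ω) [IsProbabilityMeasure μ] :
    ∃ W : TreeWalk N link, W.Induces event μ := by
  classical
  choose next hnext using hsucc
  -- Transition probabilities are conditional probabilities; at a node of measure zero, where these
  -- are undefined, all weight goes to one chosen successor.
  let p : ∀ k, N k → N (k + 1) → ENNReal := fun k x y =>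
    if link k x y then
      if μ (event k x) = 0 then (if y = next k x then 1 else 0)
      else μ (event (k + 1) y) / μ (event k x)
    else 0
  have hsum : ∀ k x, ∑' y, p k x y = 1 := by
    intro k x
    by_cases h0 : μ (event k x) = 0
    · rw [tsum_eq_single (next k x)]
      · simp [p, h0, hnext]
      · intro y hy
        simp [p, h0, hy]
    · let G : N (k + 1) → Set Ω := fun y => if link k x y then event (k + 1) y else ∅
      have hG : ∀ y ω, ω ∈ G y ↔ link k x y ∧ ω ∈ event (k + 1) y := by
        intro y ω
        by_cases h : link k x y <;> simp [G, h]
      have hp : ∀ y, p k x y = μ (G y) * (μ (event k x))⁻¹ := by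
        intro y
        by_cases h : link k x y <;> simp [p, G, h, h0, div_eq_mul_inv]
      have hU : ⋃ y, G y = event k x := by
        ext ω
        simp only [Set.mem_iUnion, hG]
        exact ⟨fun ⟨y, hy, hω⟩ => hlink k x y hy hω, hcover k x ω⟩
      simp_rw [hp]
      rw [ENNReal.tsum_mul_right, ← measure_iUnion, hU,
        ENNReal.mul_inv_cancel h0 (measure_ne_top _ _)]
      · intro y z hyz
        refine Set.disjoint_left.2 fun ω hy hz => hyz ?_
        exact hdisj _ _ _ ω ((hG _ _).1 hy).2 ((hG _ _).1 hz).2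
      · intro y
        by_cases h : link k x y <;> simp [G, h, hmeas]
  refine ⟨⟨p, fun k x y h => by simp [p, h], hsum⟩, fun k => ?_⟩
  induction k with
  | zero => intro γ _; simp [hroot]
  | succ k ih =>
    intro γ hγ
    rw [Finset.prod_range_succ, ← ih γ fun i hi => hγ i (by omega)]
    have hk := hγ k k.lt_succ_self
    -- Above a null node the arbitrary choice is harmless, since the events there are null too.
    by_cases h0 : μ (event k (γ k)) = 0
    · rw [h0, zero_mul]
      exact measure_mono_null (hlink _ _ _ hk) h0
    · simp only [p, hk, h0, if_true, if_false]
      exact (ENNReal.mul_div_cancel h0 (measure_ne_top _ _)).symm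

/-- The measure induced by a random walk on a tree with the sure event at its root is a probability
measure. -/
theorem TreeWalk.Induces.isProbabilityMeasure {N : ℕ → Type}
    {link : ∀ k, N k → N (k + 1) → Prop} {W : TreeWalk N link} {Ω : Type}
    {mΩ : MeasurableSpace Ω} {event : ∀ k, N k → Set Ω} {μ : Measure Ω}
    (h : W.Induces event μ) (γ : ∀ k, N k) (hroot : event 0 (γ 0) = Set.univ) :
    IsProbabilityMeasure μ :=
  ⟨by simpa [hroot] using h 0 γ (by simp)⟩

theorem cyl_root (C : PoscauNode 0) : cyl C = Set.univ :=
  Set.eq_univ_of_forall fun _ => Subsingleton.elim (α := LabeledCauset (Fin 1)) _ _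

theorem exists_poscauWalk_induces (ν : @Measure (LabeledCauset ℕ) cylinderAlgebra)
    (hν : IsProbabilityMeasure ν) :
    ∃ V : PoscauWalk, V.Induces (fun _ C => cyl C) ν := by
  refine exists_treeWalk_induces (N := PoscauNode) (link := poscauLink) (mΩ := cylinderAlgebra)
    (event := fun _ C => cyl C) (fun k C => measurableSet_cyl C)
    cyl_root (fun k C => ?_) ?_ ?_ ?_ ν
  · exact ⟨C.extend.restrict (k + 2), C.restrict_extend⟩
  · rintro k _ _ rfl _ rfl
    rfl
  · rintro k _ D rfl
    exact ⟨D.restrict (k + 2), rfl, rfl⟩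
  · rintro k _ _ D rfl rfl
    rfl

/-- The path of an infinite order through covtree: the sets of its `n`-stems. -/
def stemNode (D : LabeledCauset ℕ) (k : ℕ) : CovtreeNode k :=
  ⟨{A | IsStemIn A D.toOrder}, ⟨_, isStemIn_restrict D (k + 1)⟩, Or.inr ⟨D.toOrder, rfl⟩⟩

theorem mem_cert_iff {k : ℕ} {Γ : CovtreeNode k} {D : LabeledCauset ℕ} :
    D ∈ cert k Γ ↔ Γ = stemNode D k :=
  ⟨fun h => Subtype.ext h, fun h => congrArg Subtype.val h⟩

/-- A finite certificate has at least `k + 1` elements because the node is nonempty, so a chain put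
above it creates no new `(k + 1)`-stems. Infinite certificates thus suffice. -/
theorem exists_eq_stemNode {k : ℕ} (Γ : CovtreeNode k) : ∃ D, Γ = stemNode D k := by
  obtain ⟨Γ, ⟨A, hA⟩, ⟨m, B, -, hB⟩ | ⟨B, hB⟩⟩ := Γ
  · induction B using Quotient.inductionOn with | _ B
    refine ⟨B.extend, Subtype.ext ?_⟩
    have hm : k + 1 ≤ m := le_of_isStemIn (hB ▸ hA)
    exact hB.trans (Set.ext fun A => (isStemIn_extend_iff hm).symm)
  · induction B using Quotient.inductionOn with | _ B
    exact ⟨B, Subtype.ext hB⟩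

/-- For the nontrivial inclusion, the given stem is relabeled to come first; one further label then
gives a stem of the next size containing it. -/
theorem oMinus_stemNode (D : LabeledCauset ℕ) (k : ℕ) :
    oMinus (stemNode D (k + 1)).1 = (stemNode D k).1 := by
  ext B
  constructor
  · rintro ⟨A, hA, hBA⟩
    induction A using Quotient.inductionOn with | _ A
    exact isStemIn_trans hBA hA
  · intro hB
    induction B using Quotient.inductionOn with | _ B
    obtain ⟨D', hres, hD'⟩ := exists_relabeling hB
    have hmem : IsStemIn (D'.restrict (k + 2)).toOrder D.toOrder := hD' ▸ isStemIn_restrict D' _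
    refine ⟨(D'.restrict (k + 2)).toOrder, hmem, ?_⟩
    refine isStemIn_toOrder.2 ?_
    rw [← hres]
    exact nonempty_initialSeg_of_range_subset (D'.restrictInitialSeg (k + 1))
      (D'.restrictInitialSeg (k + 2)) fun i => ⟨i.castSucc, rfl⟩

theorem covtreeLink_stemNode_iff {k : ℕ} {Γ : CovtreeNode k} {D : LabeledCauset ℕ} :
    covtreeLink k Γ (stemNode D (k + 1)) ↔ Γ = stemNode D k := by
  rw [covtreeLink, oMinus_stemNode]
  exact ⟨fun h => Subtype.ext h.symm, fun h => congrArg Subtype.val h.symm⟩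

theorem measurableSet_cert {k : ℕ} (Γ : CovtreeNode k) :
    MeasurableSet[stemAlgebra] (cert k Γ) := by
  have : cert k Γ = ⋂ A : UnlabeledCauset (Fin (k + 1)), {D | A ∈ Γ.1 ↔ D ∈ stem A} := by
    ext D
    simp [cert, IsCertificate, Set.ext_iff, stem]
  rw [this]
  refine MeasurableSet.iInter fun A => ?_
  by_cases h : A ∈ Γ.1
  · simpa [h] using measurableSet_stem A
  · simpa [h, Set.compl_def] using (measurableSet_stem A).compl

theorem cert_root (Γ : CovtreeNode 0) : cert 0 Γ = Set.univ := by
  refine Set.eq_univ_of_forall fun D => mem_cert_iff.2 (Subtype.ext ?_)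
  have : Subsingleton (UnlabeledCauset (Fin (0 + 1))) :=
    inferInstanceAs (Subsingleton (UnlabeledCauset (Fin 1)))
  rw [Set.Nonempty.eq_univ Γ.2.1, Set.Nonempty.eq_univ (stemNode D 0).2.1]

instance (k : ℕ) : Finite (CovtreeNode k) := Subtype.finite

theorem exists_covtreeWalk_induces (μ : @Measure (LabeledCauset ℕ) stemAlgebra)
    (hμ : IsProbabilityMeasure μ) : IsCovtreeMeasure μ := by
  refine exists_treeWalk_induces (N := CovtreeNode) (link := covtreeLink) (mΩ := stemAlgebra)
    (event := cert) (fun k Γ => measurableSet_cert Γ)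
    cert_root (fun k Γ => ?_) ?_ ?_ ?_ μ
  · obtain ⟨D, rfl⟩ := exists_eq_stemNode Γ
    exact ⟨stemNode D (k + 1), covtreeLink_stemNode_iff.2 rfl⟩
  · intro k Γ Γ' h D hD
    rw [mem_cert_iff] at hD ⊢
    exact covtreeLink_stemNode_iff.1 (hD ▸ h)
  · intro k Γ D hD
    exact ⟨stemNode D (k + 1), covtreeLink_stemNode_iff.2 (mem_cert_iff.1 hD), mem_cert_iff.2 rfl⟩
  · intro k Γ Γ' D h h'
    exact (mem_cert_iff.1 h).trans (mem_cert_iff.1 h').symm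

theorem Extends.measure_univ {ν : @Measure (LabeledCauset ℕ) cylinderAlgebra}
    {μ : @Measure (LabeledCauset ℕ) stemAlgebra} (h : Extends ν μ) :
    ν Set.univ = μ Set.univ :=
  h _ (@MeasurableSet.univ _ stemAlgebra)

theorem isCovtreeMeasure_iff (μ : @Measure (LabeledCauset ℕ) stemAlgebra) :
    IsCovtreeMeasure μ ↔ IsProbabilityMeasure μ :=
  ⟨fun ⟨_, hW⟩ => hW.isProbabilityMeasure
    (stemNode ⟨fun _ _ => False, fun _ _ _ h _ => h, fun _ _ h => h.elim⟩) (cert_root _),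
    exists_covtreeWalk_induces μ⟩

theorem isPoscauMeasure_iff (μ : @Measure (LabeledCauset ℕ) stemAlgebra) :
    IsPoscauMeasure μ ↔ IsProbabilityMeasure μ := by
  constructor
  · rintro ⟨V, ν, hV, hν⟩
    have := hV.isProbabilityMeasure
      (fun _ => ⟨fun _ _ => False, fun _ _ _ h _ => h, fun _ _ h => h.elim⟩) (cyl_root _)
    exact ⟨hν.measure_univ ▸ this.measure_univ⟩
  · intro hμ
    obtain ⟨ν, hν⟩ := exists_extends μ
    obtain ⟨V, hV⟩ := exists_poscauWalk_induces ν ⟨hν.measure_univ.trans hμ.measure_univ⟩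
    exact ⟨V, ν, hV, hν⟩

end Walks

end Causet

theorem mainTheorem4 :
    -- the stem algebra is contained in the σ-algebra generated by the cylinder sets
    Causet.stemAlgebra ≤ Causet.cylinderAlgebra ∧
    -- every measure on the stem algebra extends to the σ-algebra generated by the cylinder sets
    (∀ μ : @MeasureTheory.Measure (Causet.LabeledCauset ℕ) Causet.stemAlgebra,
      ∃ ν : @MeasureTheory.Measure (Causet.LabeledCauset ℕ) Causet.cylinderAlgebra,
        Causet.Extends ν μ) ∧
    -- covtree measures = measures induced by labeled-poscau walks = all probability measures
    (∀ μ : @MeasureTheory.Measure (Causet.LabeledCauset ℕ) Causet.stemAlgebra,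
      (Causet.IsCovtreeMeasure μ ↔ Causet.IsPoscauMeasure μ) ∧
      (Causet.IsCovtreeMeasure μ ↔ MeasureTheory.IsProbabilityMeasure μ)) := by

  exact ⟨Causet.stemAlgebra_le_cylinderAlgebra, Causet.exists_extends, fun μ =>
    ⟨(Causet.isCovtreeMeasure_iff μ).trans (Causet.isPoscauMeasure_iff μ).symm,
      Causet.isCovtreeMeasure_iff μ⟩⟩
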